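/- Let $K\ge 2$ and let $\mu_1,\dots,\mu_K\in\mathbb R$ have a unique maximum $\mu^*=\mu_{i^*}$; put $\Delta_i=\mu^*-\mu_i$ and $\Delta_{\min}=\min_{i\ne i^*}\Delta_i$. In round $t=1,2,\dots$ a player pulls an arm $I_t\in\{1,\dots,K\}$ chosen from the past, and arm $i$ carries a clean reward $\tilde X_{i,t}\sim\mathcal N(\mu_i,\sigma^2)$, $\sigma>0$, independent of the past. An adversary attacks in each round with probability $\rho>0$, independently of the past. The player observes $\tilde X_{I_t,t}+\eta_t$ if there is an attack and $\tilde X_{I_t,t}$ otherwise; the attack value $\eta_t\in\mathbb R$ is arbitrary and unbounded, and may depend on everything that has happened up to and including round $t$. The algorithm med-E-UCB with integer group size $G\ge 2$ and parameters $b,\omega$, where $G\ge Kb\log G$, is the following. Let $n_k=\lceil b\log(kG)\rceil$. In the first $Kn_1$ rounds each arm is pulled $n_1$ times. In a round $t>Kn_1$, put $k=\lfloor t/G\rfloor$. If $k\ge1$ and $kG+1\le t\le kG+K(n_{k+1}-n_k)$, then $I_t=\lceil (t-kG)/(n_{k+1}-n_k)\rceil$. Otherwise $I_t$ is any maximizer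 over $j$ of $\mathrm{med}_j(t-1)+\sqrt{\omega\log t/T_j(t-1)}$, where $T_j(t-1)$ is the number of pulls of arm $j$ in rounds $1,\dots,t-1$ and $\mathrm{med}_j(t-1)$ is the median of the rewards observed in these pulls, i.e. $\inf\{y:\hat F(y)\ge\frac12\}$ for their empirical distribution function $\hat F$. Let $R_T=\mu^*T-\sum_{t=1}^T\mu_{I_t}$ be the regret and $\bar R_T=\mathbb E[R_T]$ the pseudo-regret. Let $\Phi$ be the distribution function of $\mathcal N(0,1)$ and $l=\frac1{\sqrt{2\pi\sigma^2}}\exp\bigl(-\frac{(\Delta_{\min}+4)^2}{32\sigma^2}\bigr)$. Suppose that $$\rho<\Phi\Bigl(\frac{\Delta_{\min}}{4\sigma}\Bigr)-\frac12,\qquad \omega\ge\frac2{l^2},\qquad b\ge\max\Bigl\{\omega,\frac{2}{(\Phi(\Delta_{\min}/(4\sigma))-\frac12-\rho)^2}\Bigr\}.$$ Then there is a constant $C>0$, depending only on $K$, $(\mu_i)_i$, $b$ and $\omega$ (and not on $\sigma,\rho,G$ or the attack), such that for all $T>G$ $$\bar R_T\le C\log T,$$ and, for every $\delta\in(0,1)$,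 with probability at least $1-\delta$ with respect to the randomness of attacks and rewards, $$R_T\le C\Bigl(\log T+\frac1\delta\Bigr).$$ -/

import Mathlib

open MeasureTheory ProbabilityTheory

namespace MedEUCB

noncomputable section

/-- The empirical CDF, at `y`, of the finite sample `(x τ)` with `τ ∈ S`. -/
def empCDF (S : Finset ℕ) (x : ℕ → ℝ) (y : ℝ) : ℝ :=
  ((S.filter (fun τ => x τ ≤ y)).card : ℝ) / (S.card : ℝ)

/-- The `p`-quantile `inf {y : F(y) ≥ p}` of the empirical distribution of a sample. -/
def empQuantile (p : ℝ) (S : Finset ℕ) (x : ℕ → ℝ) : ℝ :=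
  sInf {y : ℝ | p ≤ empCDF S x y}

/-- The sample median, i.e. the `1/2`-quantile of the empirical distribution. -/
def empMedian (S : Finset ℕ) (x : ℕ → ℝ) : ℝ := empQuantile (1 / 2) S x

/-- The set of rounds `τ ∈ {1, …, t}` in which arm `i` is pulled. -/
def pulls {K : ℕ} (I : ℕ → Fin K) (i : Fin K) (t : ℕ) : Finset ℕ :=
  (Finset.Icc 1 t).filter (fun τ => I τ = i)

/-- `⌈b log (k G)⌉`, the number of exploratory pulls of every arm that are due before block `k`
(used for `k ≥ 1` only). -/
def dueExploration (b : ℝ) (G k : ℕ) : ℕ := ⌈b * Real.log ((k : ℝ) * (G : ℝ))⌉₊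

/-- `⌈b log ((k+1) G)⌉ - ⌈b log (k G)⌉`, the number of exploratory pulls of every arm at the
beginning of block `k ≥ 1`. -/
def blockExploration (b : ℝ) (G k : ℕ) : ℕ := dueExploration b G (k + 1) - dueExploration b G k

/-- Number of rounds of the initialization phase: `K ⌈b log G⌉`. -/
def initRounds (K G : ℕ) (b : ℝ) : ℕ := K * dueExploration b G 1

/-- Round `t` (after the initialization) is a pure exploration round: with `k = ⌊t / G⌋ ≥ 1`,
`k G + 1 ≤ t ≤ k G + K (⌈b log ((k+1) G)⌉ - ⌈b log (k G)⌉)`. -/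
def IsExplorationRound (K G : ℕ) (b : ℝ) (t : ℕ) : Prop :=
  1 ≤ t / G ∧ (t / G) * G + 1 ≤ t ∧ t ≤ (t / G) * G + K * blockExploration b G (t / G)

/-- The index `med_j(t-1) + √(ω log t / T_j(t-1))` of arm `j` at round `t`, where `Y τ` is the
reward observed in round `τ`. -/
def ucbIndex {K : ℕ} (ω : ℝ) (I : ℕ → Fin K) (Y : ℕ → ℝ) (j : Fin K) (t : ℕ) : ℝ :=
  empMedian (pulls I j (t - 1)) Y
    + Real.sqrt (ω * Real.log (t : ℝ) / ((pulls I j (t - 1)).card : ℝ))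

/-- The sequence of pulled arms `I 1, I 2, …` is one that med-E-UCB, run with group size `G` and
exploration parameters `b`, `ω`, may produce when it observes the rewards `Y 1, Y 2, …`.
The order of the pulls in the initialization phase and the choice among several maximizers of the
index are left open. -/
structure IsRun {K : ℕ} (G : ℕ) (b ω : ℝ) (I : ℕ → Fin K) (Y : ℕ → ℝ) : Prop where
  /-- Initialization: in the first `K ⌈b log G⌉` rounds every arm is pulled `⌈b log G⌉` times. -/
  init : ∀ i, (pulls I i (initRounds K G b)).card = dueExploration b G 1
  /-- Pure exploration rounds; arm number `m ∈ {1, …, K}` is the element `m - 1` of `Fin K`. -/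
  explore : ∀ t, initRounds K G b < t → IsExplorationRound K G b t →
    (I t : ℕ) + 1
      = ⌈((t : ℝ) - ((t / G : ℕ) : ℝ) * (G : ℝ)) / (blockExploration b G (t / G) : ℝ)⌉₊
  /-- All other rounds are UCB rounds: an arm with the largest index is pulled. -/
  ucb : ∀ t, initRounds K G b < t → ¬ IsExplorationRound K G b t →
    ∀ j, ucbIndex ω I Y j t ≤ ucbIndex ω I Y (I t) t

/-- The reward observed in round `t`: the clean reward `X (I t) t` of the pulled arm, to which the
attack value `η t` is added on the event `A t` that the adversary attacks. -/
def observed {K : ℕ} {Ω : Type*} (X : Fin K → ℕ → Ω → ℝ) (A : ℕ → Set Ω) (η : ℕ → Ω → ℝ)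
    (I : ℕ → Ω → Fin K) (t : ℕ) (x : Ω) : ℝ :=
  X (I t x) t x + (A t).indicator (η t) x

/-- The Gaussian bandit under attack. Rounds are numbered `1, 2, …`, and `ℱ t` is everything that
has happened up to the end of round `t` (including private randomness of adversary and player).
The clean reward of arm `i` in each round is `N(μ i, σ²)` and independent of the past; the
adversary attacks in each round with probability `ρ`, independently of the past. The attack value
of a round is real and otherwise arbitrary: it may depend on the whole past, on the arm just
pulled, on the clean rewards of the round and on whether the adversary attacks. -/
structure IsAttackedGaussianBandit {K : ℕ} {Ω : Type*} {m : MeasurableSpace Ω} (P : Measure Ω)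
    (ℱ : Filtration ℕ m) (μ : Fin K → ℝ) (σ ρ : ℝ) (X : Fin K → ℕ → Ω → ℝ) (A : ℕ → Set Ω)
    (η : ℕ → Ω → ℝ) : Prop where
  reward_meas : ∀ i t, Measurable[ℱ (t + 1)] (X i (t + 1))
  reward_law : ∀ i t, P.map (X i (t + 1)) = gaussianReal (μ i) (Real.toNNReal (σ ^ 2))
  reward_indep : ∀ i t, Indep (MeasurableSpace.comap (X i (t + 1)) inferInstance) (ℱ t) P
  attack_meas : ∀ t, MeasurableSet[ℱ (t + 1)] (A (t + 1))
  attack_prob : ∀ t, P.real (A (t + 1)) = ρ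
  attack_indep : ∀ t, Indep (MeasurableSpace.generateFrom {A (t + 1)}) (ℱ t) P
  value_meas : ∀ t, Measurable[ℱ (t + 1)] (η (t + 1))

/-- The player's choices `I` come from med-E-UCB: each arm is chosen on the basis of the past, and
every trajectory is a run of the algorithm on the observed rewards. -/
structure PlaysMedEUCB {K : ℕ} {Ω : Type*} {m : MeasurableSpace Ω} (ℱ : Filtration ℕ m)
    (G : ℕ) (b ω : ℝ) (X : Fin K → ℕ → Ω → ℝ) (A : ℕ → Set Ω) (η : ℕ → Ω → ℝ)
    (I : ℕ → Ω → Fin K) : Prop where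
  nonanticipating : ∀ t, Measurable[ℱ t] (I (t + 1))
  run : ∀ x, IsRun G b ω (fun t => I t x) (fun t => observed X A η I t x)

/-- The regret `R_T = μ* T - ∑_{t=1}^T μ_{I_t}`, a random variable. -/
def regret {K : ℕ} {Ω : Type*} (μ : Fin K → ℝ) (istar : Fin K) (I : ℕ → Ω → Fin K) (T : ℕ)
    (x : Ω) : ℝ :=
  μ istar * (T : ℝ) - ∑ t ∈ Finset.Icc 1 T, μ (I t x)

/-- The pseudo-regret `μ* T - E[∑_{t=1}^T μ_{I_t}]`. -/
def pseudoRegret {K : ℕ} {Ω : Type*} {m : MeasurableSpace Ω} (P : Measure Ω) (μ : Fin K → ℝ)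
    (istar : Fin K) (I : ℕ → Ω → Fin K) (T : ℕ) : ℝ :=
  μ istar * (T : ℝ) - ∫ x, ∑ t ∈ Finset.Icc 1 T, μ (I t x) ∂P

/-- `Δ_min = min_{i ≠ i*} (μ* - μ i)` (a minimum over a nonempty finite set if `K ≥ 2`). -/
def gapMin {K : ℕ} (μ : Fin K → ℝ) (istar : Fin K) : ℝ :=
  ⨅ i : {i : Fin K // i ≠ istar}, (μ istar - μ i)

/-- The standard normal CDF. -/
def Phi (x : ℝ) : ℝ := cdf (gaussianReal 0 1) x

/-- `l = (2πσ²)^{-1/2} exp (-(Δ + 4)² / (32 σ²))`. -/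
def densityBound (Δ σ : ℝ) : ℝ :=
  1 / Real.sqrt (2 * Real.pi * σ ^ 2) * Real.exp (-((Δ + 4) ^ 2 / (32 * σ ^ 2)))

end

end MedEUCB

/-! An attack of any size corrupts one sample only, so the median is controlled by counting. Let `D`
be the minimal gap. If the median of arm `j` exceeds `μ j + D/4`, then at least half of its pulls
fell in rounds with an attack or with a clean reward above that level. Given the past, such a round
has probability at most `1 - Φ(D/(4σ)) + ρ = 1/2 - ε` with `ε > 0`; the lower side is symmetric.

The number of pulls is random and depends on the data. A multiplicative supermartingale replaces a
union bound over it: a single Markov inequality bounds by `exp(-2ε²k)` the probability that half of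
the pulls are bad while there are at least `k` of them (`inv_pow_le_pullWeight`,
`measure_inv_pow_le_tailWeight_le`). Forced exploration gives every arm `b log t - K` pulls before a
UCB round `t` (`IsRun.mul_log_le_card_pulls`). Since `b ε² ≥ 2`, some median is then wrong by more
than `D/4` with probability `O(t⁻²)`, so the expected number of bad rounds is bounded uniformly in
`T`.

When all medians are accurate, a suboptimal arm is chosen only if its bonus is at least `D/2`, hence
after at most `4ω log t / D²` pulls. Exploration rounds telescope to `O(log T)`. This bounds the
regret on every trajectory by `O(log T)` plus a multiple of the number of bad rounds; taking
expectations and applying Markov's inequality give the two claims. -/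

namespace MedEUCB

/-! ### The exploration schedule and the pulls it guarantees -/

lemma three_le_groupSize {K G : ℕ} {b : ℝ} (hK : 1 ≤ K) (hb : 8 ≤ b) (hG : 2 ≤ G)
    (h : (K : ℝ) * b * Real.log G ≤ G) : 3 ≤ G := by
  by_contra hlt
  obtain rfl : G = 2 := by omega
  have hK' : (1 : ℝ) ≤ K := by exact_mod_cast hK
  have hl := Real.log_two_gt_d9
  push_cast at h
  have h1 : (8 : ℝ) ≤ K * b := by nlinarith
  nlinarith

lemma one_le_mul_log {b : ℝ} (hb : 8 ≤ b) {G : ℕ} (hG : 3 ≤ G) :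
    1 + b * Real.log 2 ≤ b * Real.log G := by
  have hG' : (3 : ℝ) ≤ G := by exact_mod_cast hG
  have h1 : Real.log 3 ≤ Real.log G := Real.log_le_log (by norm_num) hG'
  have h2 : 1 - (3 / 2 : ℝ)⁻¹ ≤ Real.log (3 / 2) := Real.one_sub_inv_le_log_of_pos (by norm_num)
  rw [Real.log_div (by norm_num) (by norm_num)] at h2
  norm_num at h2
  nlinarith

lemma le_groupSize {K G : ℕ} {b : ℝ} (hb : 8 ≤ b) (hG : 3 ≤ G)
    (h : (K : ℝ) * b * Real.log G ≤ G) : K ≤ G := by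
  have h1 := one_le_mul_log hb hG
  have h2 : 0 ≤ Real.log 2 := Real.log_nonneg (by norm_num)
  have hK : (0 : ℝ) ≤ K := Nat.cast_nonneg K
  have : (K : ℝ) ≤ G := by nlinarith [mul_nonneg (by linarith : (0 : ℝ) ≤ b) h2]
  exact_mod_cast this

lemma dueExploration_mono {b : ℝ} (hb : 0 ≤ b) {G : ℕ} (hG : 1 ≤ G) {k : ℕ} (hk : 1 ≤ k) :
    dueExploration b G k ≤ dueExploration b G (k + 1) := by
  have hG' : (1 : ℝ) ≤ G := by exact_mod_cast hG
  have hk' : (1 : ℝ) ≤ k := by exact_mod_cast hk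
  unfold dueExploration
  gcongr
  simp

/-- The exploration of a block fits inside the block: since `(k+1)/k ≤ 2`, an arm is due fewer than
`b log 2 + 1 ≤ b log G` pulls, and `K b log G ≤ G`. -/
lemma mul_blockExploration_lt {K G : ℕ} {b : ℝ} (hK : 1 ≤ K) (hb : 8 ≤ b) (hG : 3 ≤ G)
    (h : (K : ℝ) * b * Real.log G ≤ G) {k : ℕ} (hk : 1 ≤ k) :
    K * blockExploration b G k < G := by
  have hG' : (3 : ℝ) ≤ G := by exact_mod_cast hG
  have hk' : (1 : ℝ) ≤ k := by exact_mod_cast hk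
  have hK' : (1 : ℝ) ≤ K := by exact_mod_cast hK
  have hmono := dueExploration_mono (b := b) (by linarith) (by omega : 1 ≤ G) hk
  have h1 : b * Real.log ((k : ℝ) * G) ≤ dueExploration b G k := Nat.le_ceil _
  have h2 : Real.log (((k + 1 : ℕ) : ℝ) * G) ≤ Real.log ((k : ℝ) * G) + Real.log 2 := by
    rw [← Real.log_mul (by positivity) (by norm_num)]
    apply Real.log_le_log (by positivity)
    push_cast
    nlinarith
  have h0 : 0 ≤ Real.log (((k + 1 : ℕ) : ℝ) * G) := by
    apply Real.log_nonneg
    push_cast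
    nlinarith
  have h3 : (dueExploration b G (k + 1) : ℝ) < b * Real.log (((k + 1 : ℕ) : ℝ) * G) + 1 :=
    Nat.ceil_lt_add_one (mul_nonneg (by linarith) h0)
  have h4 : (blockExploration b G k : ℝ) < b * Real.log 2 + 1 := by
    unfold blockExploration
    rw [Nat.cast_sub hmono]
    nlinarith
  have h5 := one_le_mul_log hb hG
  have : ((K * blockExploration b G k : ℕ) : ℝ) < G := by
    push_cast
    nlinarith
  exact_mod_cast this

lemma initRounds_le {K G : ℕ} {b : ℝ} (hb : 8 ≤ b) (hG : 3 ≤ G)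
    (h : (K : ℝ) * b * Real.log G ≤ G) : initRounds K G b ≤ G + K := by
  have hG' : (3 : ℝ) ≤ G := by exact_mod_cast hG
  have h0 : 0 ≤ Real.log (((1 : ℕ) : ℝ) * G) := by
    apply Real.log_nonneg
    push_cast
    linarith
  have h3 : (dueExploration b G 1 : ℝ) < b * Real.log (((1 : ℕ) : ℝ) * G) + 1 :=
    Nat.ceil_lt_add_one (mul_nonneg (by linarith) h0)
  have hK : (0 : ℝ) ≤ K := Nat.cast_nonneg K
  have : ((initRounds K G b : ℕ) : ℝ) ≤ ((G + K : ℕ) : ℝ) := by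
    unfold initRounds
    push_cast at h3 ⊢
    rw [one_mul] at h3
    nlinarith
  exact_mod_cast this

lemma card_pulls_mono {K : ℕ} (I : ℕ → Fin K) (j : Fin K) {a t : ℕ} (hat : a ≤ t) :
    (pulls I j a).card ≤ (pulls I j t).card := by
  apply Finset.card_le_card
  unfold pulls
  gcongr

lemma card_pulls_add_le {K : ℕ} (I : ℕ → Fin K) (j : Fin K) {a t : ℕ} (hat : a ≤ t)
    {S : Finset ℕ} (hS : ∀ s ∈ S, a < s ∧ s ≤ t ∧ I s = j) :
    (pulls I j a).card + S.card ≤ (pulls I j t).card := by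
  rw [← Finset.card_union_of_disjoint]
  · apply Finset.card_le_card
    intro s hs
    rcases Finset.mem_union.1 hs with hs | hs
    · simp only [pulls, Finset.mem_filter, Finset.mem_Icc] at hs ⊢
      omega
    · have := hS s hs
      simp only [pulls, Finset.mem_filter, Finset.mem_Icc]
      exact ⟨by omega, this.2.2⟩
  · rw [Finset.disjoint_left]
    intro s hs hs'
    have := hS s hs'
    simp only [pulls, Finset.mem_filter, Finset.mem_Icc] at hs
    omega

lemma IsRun.eq_of_mem_block {K G : ℕ} {b ω : ℝ} {I : ℕ → Fin K} {Y : ℕ → ℝ}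
    (hrun : IsRun G b ω I Y) {k : ℕ} (hk : 1 ≤ k) (hlt : K * blockExploration b G k < G)
    (j : Fin K) {t : ℕ} (ht : initRounds K G b < t)
    (h1 : k * G + j * blockExploration b G k < t)
    (h2 : t ≤ k * G + (j + 1) * blockExploration b G k) : I t = j := by
  set e := blockExploration b G k with he
  have hje : ((j : ℕ) + 1) * e ≤ K * e := Nat.mul_le_mul_right _ j.2
  have htk : t / G = k := by
    rw [Nat.div_eq_iff (by omega)]
    constructor <;> omega
  have hepos : 0 < e := by
    rcases Nat.eq_zero_or_pos e with h | h
    · rw [h] at h1 h2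
      omega
    · exact h
  have hex := hrun.explore t ht ⟨by omega, by rw [htk]; omega, by rw [htk, ← he]; omega⟩
  rw [htk, ← he] at hex
  have hceil : ⌈((t : ℝ) - ((k : ℕ) : ℝ) * (G : ℝ)) / (e : ℝ)⌉₊ = (j : ℕ) + 1 := by
    have hepos' : (0 : ℝ) < e := by exact_mod_cast hepos
    have h1' : (k : ℝ) * G + j * e < t := by exact_mod_cast h1
    have h2' : (t : ℝ) ≤ k * G + (j + 1) * e := by exact_mod_cast h2
    rw [Nat.ceil_eq_iff (by omega)]
    constructor
    · rw [lt_div_iff₀ hepos']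
      push_cast
      linarith
    · rw [div_le_iff₀ hepos']
      push_cast
      linarith
  rw [hceil] at hex
  exact Fin.ext (by omega)

/-- The block contributions telescope. The initialization may run up to `K` rounds past `G` and
overwrite exploration in block 1, which costs at most `K` pulls once. Later blocks start at `2G ≥ G
+ K` or beyond and are untouched. -/
lemma IsRun.dueExploration_le_card_pulls {K G : ℕ} {b ω : ℝ} {I : ℕ → Fin K} {Y : ℕ → ℝ}
    (hrun : IsRun G b ω I Y) (hK : 1 ≤ K) (hb : 8 ≤ b) (hG : 3 ≤ G)
    (h : (K : ℝ) * b * Real.log G ≤ G) (j : Fin K) {k : ℕ} (hk : 1 ≤ k) :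
    ∀ t, k * G + K * blockExploration b G k ≤ t → initRounds K G b ≤ t →
      dueExploration b G (k + 1) ≤ (pulls I j t).card + K := by
  have hinit := initRounds_le hb hG h
  have hKG := le_groupSize hb hG h
  induction k, hk using Nat.le_induction with
  | base =>
    intro t ht hti
    set e := blockExploration b G 1 with he
    have hlt := mul_blockExploration_lt hK hb hG h le_rfl
    have hje : ((j : ℕ) + 1) * e ≤ K * e := Nat.mul_le_mul_right _ j.2
    have hsplit : ((j : ℕ) + 1) * e = j * e + e := by ring
    have hmono := dueExploration_mono (b := b) (by linarith) (by omega : 1 ≤ G) le_rfl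
    have hcard := card_pulls_add_le I j hti
      (S := Finset.Ioc (max (G + j * e) (initRounds K G b)) (G + (j + 1) * e)) (by
        intro s hs
        simp only [Finset.mem_Ioc, max_lt_iff] at hs
        exact ⟨hs.1.2, by omega, hrun.eq_of_mem_block le_rfl hlt j hs.1.2
          (by rw [← he]; omega) (by rw [← he]; omega)⟩)
    rw [hrun.init j, Nat.card_Ioc] at hcard
    have : dueExploration b G (1 + 1) = dueExploration b G 1 + e := by
      rw [he]
      unfold blockExploration
      omega
    omega
  | succ k hk ih =>
    intro t ht hti
    set e := blockExploration b G (k + 1) with he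
    have hlt := mul_blockExploration_lt hK hb hG h (by omega : 1 ≤ k + 1)
    have hlt' := mul_blockExploration_lt hK hb hG h hk
    have hje : ((j : ℕ) + 1) * e ≤ K * e := Nat.mul_le_mul_right _ j.2
    have hsplit : ((j : ℕ) + 1) * e = j * e + e := by ring
    have hmono := dueExploration_mono (b := b) (by linarith) (by omega : 1 ≤ G)
      (by omega : 1 ≤ k + 1)
    have hkG : (k + 1) * G = k * G + G := by ring
    have hkG' : G ≤ k * G := Nat.le_mul_of_pos_left G hk
    have hcard := card_pulls_add_le I j (a := (k + 1) * G) (t := t) (by omega)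
      (S := Finset.Ioc ((k + 1) * G + j * e) ((k + 1) * G + (j + 1) * e)) (by
        intro s hs
        simp only [Finset.mem_Ioc] at hs
        exact ⟨by omega, by omega, hrun.eq_of_mem_block (by omega) hlt j (by omega)
          (by rw [← he]; omega) (by rw [← he]; omega)⟩)
    have := ih ((k + 1) * G) (by omega) (by omega)
    rw [Nat.card_Ioc] at hcard
    have : dueExploration b G (k + 1 + 1) = dueExploration b G (k + 1) + e := by
      rw [he]
      unfold blockExploration
      omega
    omega

/-- In a UCB round every arm has already been pulled at least `b log t - K` times. -/
lemma IsRun.mul_log_le_card_pulls {K G : ℕ} {b ω : ℝ} {I : ℕ → Fin K} {Y : ℕ → ℝ}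
    (hrun : IsRun G b ω I Y) (hK : 1 ≤ K) (hb : 8 ≤ b) (hG : 3 ≤ G)
    (h : (K : ℝ) * b * Real.log G ≤ G) (j : Fin K) {t : ℕ} (ht : initRounds K G b < t)
    (hexp : ¬ IsExplorationRound K G b t) :
    b * Real.log t ≤ (pulls I j (t - 1)).card + K := by
  have hG' : (3 : ℝ) ≤ G := by exact_mod_cast hG
  have ht0 : (0 : ℝ) < t := by exact_mod_cast (by omega : 0 < t)
  -- Blocks are cut by `(t - 1) / G`, not `t / G`: round `(k+1)G` is never exploratory and closes
  -- block `k`, so that `t ≤ (k+1)G` holds.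
  rcases Nat.eq_zero_or_pos ((t - 1) / G) with hk | hk
  · have htG : t - 1 < G := (Nat.div_eq_zero_iff.1 hk).resolve_left (by omega)
    have h1 : b * Real.log ((1 : ℕ) * G) ≤ dueExploration b G 1 := Nat.le_ceil _
    have h2 := card_pulls_mono I j (by omega : initRounds K G b ≤ t - 1)
    rw [hrun.init j] at h2
    have h2' : (dueExploration b G 1 : ℝ) ≤ (pulls I j (t - 1)).card := by exact_mod_cast h2
    have h3 : Real.log t ≤ Real.log ((1 : ℕ) * G) := by
      apply Real.log_le_log ht0
      push_cast
      rw [one_mul]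
      exact_mod_cast (by omega : t ≤ G)
    have : (0 : ℝ) ≤ K := Nat.cast_nonneg K
    nlinarith
  · set k := (t - 1) / G with hkdef
    have hlt := mul_blockExploration_lt hK hb hG h hk
    have hmod := Nat.div_add_mod (t - 1) G
    have hmodlt := Nat.mod_lt (t - 1) (by omega : 0 < G)
    rw [mul_comm, ← hkdef] at hmod
    have hge : k * G + K * blockExploration b G k < t := by
      by_contra hle
      have htk : t / G = k := by
        rw [Nat.div_eq_iff (by omega)]
        constructor <;> omega
      exact hexp ⟨by omega, by rw [htk]; omega, by rw [htk]; omega⟩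
    have h2 := hrun.dueExploration_le_card_pulls hK hb hG h j hk (t - 1) (by omega) (by omega)
    have h1 : b * Real.log (((k + 1 : ℕ) : ℝ) * G) ≤ dueExploration b G (k + 1) :=
      Nat.le_ceil _
    have h2' : (dueExploration b G (k + 1) : ℝ) ≤ (pulls I j (t - 1)).card + K := by
      exact_mod_cast h2
    have h3 : Real.log t ≤ Real.log (((k + 1 : ℕ) : ℝ) * G) := by
      apply Real.log_le_log ht0
      have : t ≤ (k + 1) * G := by
        rw [Nat.add_mul]
        omega
      exact_mod_cast this
    nlinarith

lemma IsRun.card_pulls_pos {K G : ℕ} {b ω : ℝ} {I : ℕ → Fin K} {Y : ℕ → ℝ}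
    (hrun : IsRun G b ω I Y) (hb : 8 ≤ b) (hG : 3 ≤ G) (j : Fin K) {t : ℕ}
    (ht : initRounds K G b < t) : 0 < (pulls I j (t - 1)).card := by
  have h2 := card_pulls_mono I j (by omega : initRounds K G b ≤ t - 1)
  rw [hrun.init j] at h2
  refine lt_of_lt_of_le (Nat.ceil_pos.2 ?_) h2
  have hG' : (3 : ℝ) ≤ G := by exact_mod_cast hG
  have : 0 < Real.log ((1 : ℕ) * G) := Real.log_pos (by push_cast; linarith)
  positivity

lemma sum_blockExploration_le {b : ℝ} (hb : 0 ≤ b) {G : ℕ} (hG : 1 ≤ G) (n : ℕ) :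
    ∑ k ∈ Finset.Icc 1 n, blockExploration b G k ≤ dueExploration b G (n + 1) := by
  induction n with
  | zero => simp
  | succ n ih =>
    rw [Finset.sum_Icc_succ_top (by omega)]
    have := dueExploration_mono (b := b) hb hG (by omega : 1 ≤ n + 1)
    unfold blockExploration at ih ⊢
    omega

/-- The number of pure exploration rounds up to round `T` is at most `K ⌈b log ((⌊T/G⌋+1) G)⌉`. -/
lemma card_explorationRounds_le {K G : ℕ} {b : ℝ} (hb : 0 ≤ b) (hG : 1 ≤ G) (T : ℕ)
    {S : Finset ℕ} (hS : ∀ t ∈ S, t ≤ T ∧ IsExplorationRound K G b t) :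
    S.card ≤ K * dueExploration b G (T / G + 1) := by
  calc S.card ≤ ((Finset.Icc 1 (T / G)).biUnion fun k =>
        Finset.Ioc (k * G) (k * G + K * blockExploration b G k)).card := by
        apply Finset.card_le_card
        intro t ht
        obtain ⟨h1, h2, h3, h4⟩ := hS t ht
        simp only [Finset.mem_biUnion, Finset.mem_Icc, Finset.mem_Ioc]
        exact ⟨t / G, ⟨h2, Nat.div_le_div_right h1⟩, by omega, h4⟩
    _ ≤ ∑ k ∈ Finset.Icc 1 (T / G), (Finset.Ioc (k * G) (k * G + K * blockExploration b G k)).card :=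
        Finset.card_biUnion_le
    _ = K * ∑ k ∈ Finset.Icc 1 (T / G), blockExploration b G k := by
        rw [Finset.mul_sum]
        exact Finset.sum_congr rfl fun k _ => by rw [Nat.card_Ioc]; omega
    _ ≤ _ := Nat.mul_le_mul_left _ (sum_blockExploration_le hb hG _)

end MedEUCB

/-! ### Median deviations as counting statements -/

namespace MedEUCB

/-- Real `sInf` takes a default value on sets that are empty or unbounded below; this lemma and the
next one exclude both. -/
lemma bddBelow_le_empCDF {p : ℝ} (hp : 0 < p) (S : Finset ℕ) (x : ℕ → ℝ) :
    BddBelow {y : ℝ | p ≤ empCDF S x y} := by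
  obtain ⟨m, hm⟩ := (S.image x).bddBelow
  refine ⟨m, fun y hy => ?_⟩
  by_contra hlt
  have hempty : S.filter (fun τ => x τ ≤ y) = ∅ := by
    rw [Finset.filter_eq_empty_iff]
    intro τ hτ hle
    exact absurd (hm (Finset.mem_coe.2 (Finset.mem_image_of_mem x hτ))) (by linarith)
  simp only [Set.mem_ofPred_eq, empCDF, hempty, Finset.card_empty, Nat.cast_zero, zero_div] at hy
  linarith

lemma nonempty_le_empCDF {p : ℝ} (hp : p ≤ 1) {S : Finset ℕ} (hS : 0 < S.card) (x : ℕ → ℝ) :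
    {y : ℝ | p ≤ empCDF S x y}.Nonempty := by
  obtain ⟨m, hm⟩ := (S.image x).bddAbove
  refine ⟨m, ?_⟩
  have hall : S.filter (fun τ => x τ ≤ m) = S := by
    rw [Finset.filter_eq_self]
    exact fun τ hτ => hm (Finset.mem_coe.2 (Finset.mem_image_of_mem x hτ))
  have : (S.card : ℝ) ≠ 0 := by positivity
  simp only [Set.mem_ofPred_eq, empCDF, hall]
  rwa [div_self this]

/-- A median above `y` forces at least half of the sample to exceed `y`. -/
lemma card_le_of_lt_empMedian {S : Finset ℕ} (hS : 0 < S.card) {x : ℕ → ℝ} {y : ℝ}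
    (h : y < empMedian S x) : S.card ≤ 2 * (S.filter (fun τ => y < x τ)).card := by
  have hF : empCDF S x y < 1 / 2 := by
    by_contra hge
    exact absurd (csInf_le (bddBelow_le_empCDF (by norm_num) S x) (not_lt.1 hge)) (not_le.2 h)
  have hS' : (0 : ℝ) < S.card := by exact_mod_cast hS
  rw [empCDF, div_lt_iff₀ hS'] at hF
  have hF' : 2 * (S.filter (fun τ => x τ ≤ y)).card < S.card := by
    have : (2 : ℝ) * (S.filter (fun τ => x τ ≤ y)).card < S.card := by linarith
    exact_mod_cast this
  have := Finset.card_filter_add_card_filter_not (s := S) (fun τ => x τ ≤ y)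
  simp only [not_le] at this
  omega

/-- A median below `y` forces at least half of the sample to be below `y`. -/
lemma card_le_of_empMedian_lt {S : Finset ℕ} (hS : 0 < S.card) {x : ℕ → ℝ} {y : ℝ}
    (h : empMedian S x < y) : S.card ≤ 2 * (S.filter (fun τ => x τ < y)).card := by
  obtain ⟨z, hz, hzy⟩ := exists_lt_of_csInf_lt (nonempty_le_empCDF (by norm_num) hS x) h
  have hS' : (0 : ℝ) < S.card := by exact_mod_cast hS
  rw [Set.mem_ofPred_eq, empCDF, le_div_iff₀ hS'] at hz
  have hz' : S.card ≤ 2 * (S.filter (fun τ => x τ ≤ z)).card := by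
    have : (S.card : ℝ) ≤ 2 * (S.filter (fun τ => x τ ≤ z)).card := by linarith
    exact_mod_cast this
  refine hz'.trans (Nat.mul_le_mul_left _ (Finset.card_le_card fun τ hτ => ?_))
  rw [Finset.mem_filter] at hτ ⊢
  exact ⟨hτ.1, hτ.2.trans_lt hzy⟩

end MedEUCB

/-! ### A supermartingale tail bound for an adaptive number of pulls -/

namespace MedEUCB

open scoped ENNReal

/-- The product over the pulls of arm `j` up to round `n` of `c + d` in the rounds `τ` where `E τ`
occurs and of `c` in the others. -/
noncomputable def pullWeight {K : ℕ} {Ω : Type*} (c d : ℝ≥0∞) (E : ℕ → Set Ω)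
    (I : ℕ → Ω → Fin K) (j : Fin K) (n : ℕ) (x : Ω) : ℝ≥0∞ :=
  ∏ τ ∈ pulls (fun t => I t x) j n, (c + d * (E τ).indicator 1 x)

/-- Written as a sum so that, in each term, the indicator of `E (n + 1)` is the only factor not
determined by the first `n` rounds. -/
lemma pullWeight_succ {K : ℕ} {Ω : Type*} (c d : ℝ≥0∞) (E : ℕ → Set Ω)
    (I : ℕ → Ω → Fin K) (j : Fin K) (n : ℕ) :
    pullWeight c d E I j (n + 1) = fun x =>
      {x | I (n + 1) x = j}ᶜ.indicator (pullWeight c d E I j n) x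
        + (c * {x | I (n + 1) x = j}.indicator (pullWeight c d E I j n) x
          + d * ({x | I (n + 1) x = j}.indicator (pullWeight c d E I j n) x
            * (E (n + 1)).indicator 1 x)) := by
  funext x
  have hstep : pullWeight c d E I j (n + 1) x = pullWeight c d E I j n x *
      if I (n + 1) x = j then c + d * (E (n + 1)).indicator 1 x else 1 := by
    simp only [pullWeight, pulls, Finset.prod_filter]
    rw [Finset.prod_Icc_succ_top (by omega)]
  rw [hstep]
  by_cases h : I (n + 1) x = j
  · have h1 : x ∈ {x | I (n + 1) x = j} := h
    have h2 : x ∉ {x | I (n + 1) x = j}ᶜ := fun hc => hc h1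
    rw [Set.indicator_of_notMem h2, Set.indicator_of_mem h1, if_pos h]
    ring
  · have h1 : x ∉ {x | I (n + 1) x = j} := h
    have h2 : x ∈ {x | I (n + 1) x = j}ᶜ := h1
    rw [Set.indicator_of_mem h2, Set.indicator_of_notMem h1, if_neg h]
    simp

lemma measurable_weightStep {Ω : Type*} [MeasurableSpace Ω] (c d : ℝ≥0∞) {W : Ω → ℝ≥0∞}
    {J E : Set Ω} (hW : Measurable W) (hJ : MeasurableSet J) (hE : MeasurableSet E) :
    Measurable fun x => Jᶜ.indicator W x + (c * J.indicator W x
      + d * (J.indicator W x * E.indicator 1 x)) :=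
  (hW.indicator hJ.compl).add (((hW.indicator hJ).const_mul c).add
    (((hW.indicator hJ).mul (measurable_one.indicator hE)).const_mul d))

lemma measurable_pullWeight {K : ℕ} {Ω : Type*} {m : MeasurableSpace Ω} {ℱ : Filtration ℕ m}
    (c d : ℝ≥0∞) {E : ℕ → Set Ω} {I : ℕ → Ω → Fin K} (j : Fin K)
    (hI : ∀ t, Measurable[ℱ t] (I (t + 1))) (hE : ∀ t, MeasurableSet[ℱ (t + 1)] (E (t + 1)))
    (n : ℕ) : Measurable[ℱ n] (pullWeight c d E I j n) := by
  induction n with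
  | zero =>
    have : pullWeight c d E I j 0 = fun _ => 1 := by
      funext x
      simp [pullWeight, pulls]
    rw [this]
    exact measurable_const
  | succ n ih =>
    have hle : ℱ n ≤ ℱ (n + 1) := ℱ.mono (Nat.le_succ n)
    have hJ : MeasurableSet[ℱ (n + 1)] {x | I (n + 1) x = j} :=
      hle _ (hI n (measurableSet_singleton j))
    have ih' : Measurable[ℱ (n + 1)] (pullWeight c d E I j n) := ih.mono hle le_rfl
    rw [pullWeight_succ]
    exact @measurable_weightStep Ω (ℱ (n + 1)) c d _ _ _ ih' hJ (hE n)

/-- If `E (t + 1)` has conditional probability at most `q` given the past, and `c + d q ≤ 1`, then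
the weight process is a supermartingale started at `1`. -/
lemma lintegral_pullWeight_le {K : ℕ} {Ω : Type*} {m : MeasurableSpace Ω} {P : Measure Ω}
    [IsProbabilityMeasure P] {ℱ : Filtration ℕ m} {c d q : ℝ≥0∞} (hcdq : c + d * q ≤ 1)
    {E : ℕ → Set Ω} {I : ℕ → Ω → Fin K} (j : Fin K)
    (hI : ∀ t, Measurable[ℱ t] (I (t + 1))) (hE : ∀ t, MeasurableSet[ℱ (t + 1)] (E (t + 1)))
    (hq : ∀ t (f : Ω → ℝ≥0∞), Measurable[ℱ t] f →
      ∫⁻ x, f x * (E (t + 1)).indicator 1 x ∂P ≤ q * ∫⁻ x, f x ∂P) (n : ℕ) :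
    ∫⁻ x, pullWeight c d E I j n x ∂P ≤ 1 := by
  induction n with
  | zero => simp [pullWeight, pulls]
  | succ n ih =>
    have hmn := measurable_pullWeight c d j hI hE n
    have hJ : MeasurableSet[ℱ n] {x | I (n + 1) x = j} := hI n (measurableSet_singleton j)
    have hm := hmn.mono (ℱ.le n) le_rfl
    have hJm := ℱ.le n _ hJ
    have hEm := ℱ.le (n + 1) _ (hE n)
    have hf := hmn.indicator hJ
    have hfm := hf.mono (ℱ.le n) le_rfl
    have hgm : Measurable ((E (n + 1)).indicator (1 : Ω → ℝ≥0∞)) := measurable_one.indicator hEm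
    rw [pullWeight_succ, lintegral_add_left (hm.indicator hJm.compl),
      lintegral_add_left (hfm.const_mul c), lintegral_const_mul c hfm,
      lintegral_const_mul d (f := fun x => _ * _) (hfm.mul hgm)]
    set f := {x | I (n + 1) x = j}.indicator (pullWeight c d E I j n) with hfdef
    calc _ ≤ ∫⁻ x, {x | I (n + 1) x = j}ᶜ.indicator (pullWeight c d E I j n) x ∂P
          + (c * ∫⁻ x, f x ∂P + d * (q * ∫⁻ x, f x ∂P)) := by
          gcongr
          exact hq n f hf
      _ = ∫⁻ x, {x | I (n + 1) x = j}ᶜ.indicator (pullWeight c d E I j n) x ∂P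
          + (c + d * q) * ∫⁻ x, f x ∂P := by ring
      _ ≤ ∫⁻ x, {x | I (n + 1) x = j}ᶜ.indicator (pullWeight c d E I j n) x ∂P
          + 1 * ∫⁻ x, f x ∂P := by gcongr
      _ = ∫⁻ x, pullWeight c d E I j n x ∂P := by
          rw [one_mul, hfdef, lintegral_indicator hJm.compl, lintegral_indicator hJm, add_comm,
            lintegral_add_compl _ hJm]
      _ ≤ 1 := ih

/-- The union bound is applied under the integral, so reward and attack need only be independent of
the past separately, not of each other. -/
lemma lintegral_mul_indicator_union_le {Ω α : Type*} [MeasurableSpace α]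
    {m₀ m : MeasurableSpace Ω} {P : Measure Ω} (hm₀ : m₀ ≤ m)
    {X : Ω → α} (hX : Measurable X)
    {A : Set Ω} (hA : MeasurableSet A)
    (hXi : Indep (MeasurableSpace.comap X inferInstance) m₀ P)
    (hAi : Indep (MeasurableSpace.generateFrom {A}) m₀ P) {s : Set α} (hs : MeasurableSet s)
    {f : Ω → ℝ≥0∞} (hf : Measurable[m₀] f) :
    ∫⁻ x, f x * (X ⁻¹' s ∪ A).indicator 1 x ∂P ≤ (P (X ⁻¹' s) + P A) * ∫⁻ x, f x ∂P := by
  have key : ∀ B : Set Ω, MeasurableSet B → IndepSets {t | MeasurableSet[m₀] t} {B} P →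
      ∫⁻ x, f x * B.indicator 1 x ∂P = P B * ∫⁻ x, f x ∂P := by
    intro B hB hi
    have h1 := lintegral_mul_indicator_eq_lintegral_mul_lintegral_indicator hm₀ 1 hB hi hf
    rw [lintegral_indicator_const hB, one_mul] at h1
    rw [mul_comm, ← h1]
    rfl
  have hfm := hf.mono hm₀ le_rfl
  calc _ ≤ ∫⁻ x, (f x * (X ⁻¹' s).indicator 1 x + f x * A.indicator 1 x) ∂P := by
        apply lintegral_mono
        intro x
        dsimp only
        rw [← mul_add]
        gcongr
        by_cases h1 : x ∈ X ⁻¹' s <;> by_cases h2 : x ∈ A <;> simp [Set.indicator, h1, h2]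
    _ = P (X ⁻¹' s) * ∫⁻ x, f x ∂P + P A * ∫⁻ x, f x ∂P := by
        rw [lintegral_add_left (f := fun x => _ * _) (hfm.mul (measurable_one.indicator (hX hs))),
          key _ (hX hs), key _ hA]
        · exact indepSets_of_indepSets_of_le_right ((Indep_iff_IndepSets _ _ _).1 hAi.symm)
            (Set.singleton_subset_iff.2 (MeasurableSpace.measurableSet_generateFrom rfl))
        · exact indepSets_of_indepSets_of_le_right ((Indep_iff_IndepSets _ _ _).1 hXi.symm)
            (Set.singleton_subset_iff.2 ⟨s, hs, rfl⟩)
    _ = _ := by ring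

/-- With `r = 1 + 2ε` and `g = 1 - 2ε²`, each pull contributes at least `1/(rg)`, and those in `S`
contribute `r/g`. When `S` is at least half of the pulls, the powers of `r` multiply to at least 1,
leaving `g⁻¹` to the number of pulls. -/
lemma inv_pow_le_pullWeight {K : ℕ} {Ω : Type*} {ε : ℝ} (h0 : 0 ≤ ε) (h1 : ε ≤ 1 / 2)
    {E : ℕ → Set Ω} {I : ℕ → Ω → Fin K} {j : Fin K} {n k : ℕ} {x : Ω} {S : Finset ℕ}
    (hk : k ≤ (pulls (fun t => I t x) j n).card)
    (hSE : ∀ τ ∈ S, x ∈ E τ) (hSp : S ⊆ pulls (fun t => I t x) j n)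
    (hS : (pulls (fun t => I t x) j n).card ≤ 2 * S.card) :
    ENNReal.ofReal ((1 - 2 * ε ^ 2)⁻¹ ^ k) ≤
      pullWeight (ENNReal.ofReal (((1 + 2 * ε) * (1 - 2 * ε ^ 2))⁻¹))
        (ENNReal.ofReal ((1 + 2 * ε) * (1 - 2 * ε ^ 2)⁻¹ - ((1 + 2 * ε) * (1 - 2 * ε ^ 2))⁻¹))
        E I j n x := by
  set r := 1 + 2 * ε with hr
  set g := 1 - 2 * ε ^ 2 with hg
  have hr1 : 1 ≤ r := by linarith
  have hg0 : 0 < g := by nlinarith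
  have hg1 : g ≤ 1 := by nlinarith
  have hginv : 1 ≤ g⁻¹ := (one_le_inv₀ hg0).2 hg1
  have hca : (r * g)⁻¹ ≤ r * g⁻¹ := by
    rw [mul_inv]
    gcongr
    exact (inv_le_one_of_one_le₀ hr1).trans hr1
  have hc0 : 0 ≤ (r * g)⁻¹ := by positivity
  unfold pullWeight
  set Q := pulls (fun t => I t x) j n
  have hsplit : ∏ τ ∈ Q, (ENNReal.ofReal (r * g)⁻¹ + ENNReal.ofReal (r * g⁻¹ - (r * g)⁻¹) *
      (E τ).indicator 1 x) ≥ ENNReal.ofReal ((r * g)⁻¹ ^ (Q.card - S.card) * (r * g⁻¹) ^ S.card) := by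
    rw [← Finset.prod_sdiff hSp, ENNReal.ofReal_mul (by positivity), ENNReal.ofReal_pow hc0,
      ENNReal.ofReal_pow (by positivity), ← Finset.card_sdiff_of_subset hSp, ← Finset.prod_const,
      ← Finset.prod_const]
    gcongr with τ hτ τ hτ
    · exact le_self_add
    · rw [Set.indicator_of_mem (hSE τ hτ), Pi.one_apply, mul_one,
        ← ENNReal.ofReal_add hc0 (by linarith)]
      simp
  refine le_trans (ENNReal.ofReal_le_ofReal ?_) hsplit
  have hSQ := Finset.card_le_card hSp
  have hrpos : 0 < r := by linarith
  calc g⁻¹ ^ k ≤ g⁻¹ ^ Q.card := pow_le_pow_right₀ hginv hk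
    _ = 1 * g⁻¹ ^ Q.card := (one_mul _).symm
    _ ≤ (r⁻¹ ^ (Q.card - S.card) * r ^ S.card) * g⁻¹ ^ Q.card := by
        gcongr
        rw [inv_pow, ← div_eq_inv_mul, one_le_div (by positivity)]
        exact pow_le_pow_right₀ hr1 (by omega)
    _ = _ := by
        obtain ⟨e, he⟩ : ∃ e, Q.card = e + S.card := ⟨Q.card - S.card, by omega⟩
        rw [he, Nat.add_sub_cancel, mul_inv, mul_pow, mul_pow, pow_add]
        ring

/-- The weight `pullWeight` with the parameters used for the tail bound at margin `ε`. -/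
noncomputable def tailWeight {K : ℕ} {Ω : Type*} (ε : ℝ) (E : ℕ → Set Ω)
    (I : ℕ → Ω → Fin K) (j : Fin K) (n : ℕ) : Ω → ℝ≥0∞ :=
  pullWeight (ENNReal.ofReal (((1 + 2 * ε) * (1 - 2 * ε ^ 2))⁻¹))
    (ENNReal.ofReal ((1 + 2 * ε) * (1 - 2 * ε ^ 2)⁻¹ - ((1 + 2 * ε) * (1 - 2 * ε ^ 2))⁻¹)) E I j n

lemma measure_inv_pow_le_tailWeight_le {K : ℕ} {Ω : Type*} {m : MeasurableSpace Ω}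
    {P : Measure Ω} [IsProbabilityMeasure P] {ℱ : Filtration ℕ m} {ε : ℝ} (h0 : 0 ≤ ε)
    (h1 : ε ≤ 1 / 2) {E : ℕ → Set Ω} {I : ℕ → Ω → Fin K} (j : Fin K)
    (hI : ∀ t, Measurable[ℱ t] (I (t + 1))) (hE : ∀ t, MeasurableSet[ℱ (t + 1)] (E (t + 1)))
    (hq : ∀ t (f : Ω → ℝ≥0∞), Measurable[ℱ t] f →
      ∫⁻ x, f x * (E (t + 1)).indicator 1 x ∂P ≤ ENNReal.ofReal (1 / 2 - ε) * ∫⁻ x, f x ∂P)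
    (n k : ℕ) :
    P {x | ENNReal.ofReal ((1 - 2 * ε ^ 2)⁻¹ ^ k) ≤ tailWeight ε E I j n x} ≤
      ENNReal.ofReal (Real.exp (-(2 * ε ^ 2 * k))) := by
  have hg0 : 0 < 1 - 2 * ε ^ 2 := by nlinarith
  have hr0 : 0 < 1 + 2 * ε := by linarith
  have hca : ((1 + 2 * ε) * (1 - 2 * ε ^ 2))⁻¹ ≤ (1 + 2 * ε) * (1 - 2 * ε ^ 2)⁻¹ := by
    rw [mul_inv]
    gcongr
    exact (inv_le_one_of_one_le₀ (by linarith)).trans (by linarith)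
  have hint : ∫⁻ x, tailWeight ε E I j n x ∂P ≤ 1 := by
    refine lintegral_pullWeight_le ?_ j hI hE hq n
    rw [← ENNReal.ofReal_mul (by linarith), ← ENNReal.ofReal_add (by positivity)
      (mul_nonneg (by linarith) (by linarith)), ENNReal.ofReal_le_one]
    -- The parameters are tuned for equality: `(1/2 + ε)/r + (1/2 - ε) r = g`, because `1/2 + ε =
    -- r/2`.
    apply le_of_eq
    field_simp
    ring
  have hmeas := (measurable_pullWeight (ENNReal.ofReal (((1 + 2 * ε) * (1 - 2 * ε ^ 2))⁻¹))
    (ENNReal.ofReal ((1 + 2 * ε) * (1 - 2 * ε ^ 2)⁻¹ - ((1 + 2 * ε) * (1 - 2 * ε ^ 2))⁻¹))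
    j hI hE n).mono (ℱ.le n) le_rfl
  have hmk := (mul_meas_ge_le_lintegral (μ := P) hmeas
    (ENNReal.ofReal ((1 - 2 * ε ^ 2)⁻¹ ^ k))).trans hint
  have hpos : 0 < (1 - 2 * ε ^ 2)⁻¹ ^ k := by positivity
  calc _ ≤ (ENNReal.ofReal ((1 - 2 * ε ^ 2)⁻¹ ^ k))⁻¹ := by
        rw [ENNReal.le_inv_iff_mul_le, mul_comm]
        exact hmk
    _ = ENNReal.ofReal ((1 - 2 * ε ^ 2) ^ k) := by
        rw [← ENNReal.ofReal_inv_of_pos hpos, inv_pow, inv_inv]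
    _ ≤ _ := by
        apply ENNReal.ofReal_le_ofReal
        calc (1 - 2 * ε ^ 2) ^ k ≤ (Real.exp (-(2 * ε ^ 2))) ^ k := by
              gcongr
              exact Real.one_sub_le_exp_neg _
          _ = _ := by
              rw [← Real.exp_nat_mul]
              congr 1
              ring

lemma Phi_le_one (x : ℝ) : Phi x ≤ 1 := cdf_le_one _ x

lemma gaussianReal_Ioi {σ a : ℝ} (hσ : 0 < σ) (μ : ℝ) :
    gaussianReal μ (Real.toNNReal (σ ^ 2)) (Set.Ioi (μ + a)) =
      ENNReal.ofReal (1 - Phi (a / σ)) := by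
  have hlaw : gaussianReal μ (Real.toNNReal (σ ^ 2)) =
      (gaussianReal 0 1).map (fun x => σ * x + μ) := by
    have h1 := gaussianReal_map_const_mul (μ := 0) (v := 1) σ
    have h2 := gaussianReal_map_add_const (μ := σ * 0) (v := (NNReal.mk (σ ^ 2) (sq_nonneg σ)) * 1) μ
    rw [← h1, Measure.map_map (by fun_prop) (by fun_prop)] at h2
    have hv : Real.toNNReal (σ ^ 2) = (NNReal.mk (σ ^ 2) (sq_nonneg σ)) * 1 := by
      rw [mul_one]
      exact Real.toNNReal_of_nonneg (sq_nonneg σ)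
    rw [hv]
    simpa [Function.comp_def] using h2.symm
  rw [hlaw, Measure.map_apply (by fun_prop) measurableSet_Ioi]
  have hset : (fun x => σ * x + μ) ⁻¹' Set.Ioi (μ + a) = (Set.Iic (a / σ))ᶜ := by
    ext x
    simp only [Set.mem_preimage, Set.mem_Ioi, Set.mem_compl_iff, Set.mem_Iic, not_le,
      div_lt_iff₀ hσ]
    constructor <;> intro h <;> linarith
  rw [hset, ← ofReal_measureReal, probReal_compl_eq_one_sub measurableSet_Iic, Phi, cdf_eq_real]

lemma gaussianReal_Iio {σ a : ℝ} (hσ : 0 < σ) (μ : ℝ) :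
    gaussianReal μ (Real.toNNReal (σ ^ 2)) (Set.Iio (μ - a)) =
      ENNReal.ofReal (1 - Phi (a / σ)) := by
  have h1 := gaussianReal_map_neg (μ := -μ) (v := Real.toNNReal (σ ^ 2))
  rw [neg_neg] at h1
  rw [← gaussianReal_Ioi hσ (-μ), ← h1, Measure.map_apply (by fun_prop) measurableSet_Iio]
  congr 1
  ext x
  simp only [Set.mem_preimage, Set.mem_Iio, Set.mem_Ioi]
  constructor <;> intro h <;> linarith

end MedEUCB

/-! ### Counting suboptimal pulls on a trajectory -/

namespace MedEUCB

open scoped ENNReal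

lemma gapMin_le {K : ℕ} (μ : Fin K → ℝ) (istar : Fin K) {i : Fin K} (hi : i ≠ istar) :
    gapMin μ istar ≤ μ istar - μ i :=
  ciInf_le (Set.finite_range fun i : {i : Fin K // i ≠ istar} => μ istar - μ i).bddBelow ⟨i, hi⟩

lemma gapMin_pos {K : ℕ} (hK : 2 ≤ K) {μ : Fin K → ℝ} {istar : Fin K}
    (hstar : ∀ i, i ≠ istar → μ i < μ istar) : 0 < gapMin μ istar := by
  have : Nontrivial (Fin K) := Fin.nontrivial_iff_two_le.2 hK
  obtain ⟨i₀, hi₀⟩ := exists_ne istar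
  have : Nonempty {i : Fin K // i ≠ istar} := ⟨⟨i₀, hi₀⟩⟩
  obtain ⟨i, hi⟩ := exists_eq_ciInf_of_finite
    (f := fun i : {i : Fin K // i ≠ istar} => μ istar - μ i)
  unfold gapMin
  rw [← hi]
  exact sub_pos.2 (hstar i i.2)

/-- The number of rounds of a set in which arm `i` is pulled after fewer than `m` earlier pulls. -/
lemma card_le_of_card_pulls_le {K : ℕ} {I : ℕ → Fin K} {i : Fin K} {S : Finset ℕ} {B : ℝ}
    (hB : 0 ≤ B) (hS : ∀ t ∈ S, 1 ≤ t ∧ I t = i ∧ ((pulls I i (t - 1)).card : ℝ) ≤ B) :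
    (S.card : ℝ) ≤ B + 1 := by
  rcases S.eq_empty_or_nonempty with rfl | hne
  · simp
    linarith
  · have hmax := S.max'_mem hne
    -- At the last round of `S`, all other rounds of `S` are earlier pulls of `i`.
    have hsub : S.erase (S.max' hne) ⊆ pulls I i (S.max' hne - 1) := by
      intro t ht
      have h1 := S.lt_max'_of_mem_erase_max' hne ht
      have h2 := hS t (Finset.mem_of_mem_erase ht)
      simp only [pulls, Finset.mem_filter, Finset.mem_Icc]
      exact ⟨by omega, h2.2.1⟩
    have h1 := Finset.card_le_card hsub
    have h2 := Finset.card_erase_add_one hmax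
    have h3 := (hS _ hmax).2.2
    have h1' : ((S.erase (S.max' hne)).card : ℝ) ≤ (pulls I i (S.max' hne - 1)).card := by
      exact_mod_cast h1
    have h2' : ((S.erase (S.max' hne)).card : ℝ) + 1 = S.card := by exact_mod_cast h2
    linarith

/-- In a UCB round with accurate medians, a suboptimal arm is pulled only if it has been pulled
at most `4 ω log t / D²` times before. -/
lemma IsRun.card_pulls_le_of_suboptimal {K G : ℕ} {b ω D : ℝ} {I : ℕ → Fin K} {Y : ℕ → ℝ}
    (hrun : IsRun G b ω I Y) (hω : 0 ≤ ω) (hD : 0 < D) {μ : Fin K → ℝ} {istar : Fin K}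
    (hgap : ∀ i, i ≠ istar → D ≤ μ istar - μ i) {t : ℕ} (ht : initRounds K G b < t)
    (hexp : ¬ IsExplorationRound K G b t)
    (hmed : ∀ j, |empMedian (pulls I j (t - 1)) Y - μ j| ≤ D / 4) (hne : I t ≠ istar) :
    ((pulls I (I t) (t - 1)).card : ℝ) ≤ 4 * ω * Real.log t / D ^ 2 := by
  have hucb := hrun.ucb t ht hexp istar
  unfold ucbIndex at hucb
  have h1 := (abs_le.1 (hmed istar)).1
  have h2 := (abs_le.1 (hmed (I t))).2
  have h3 := hgap _ hne
  have h4 : 0 ≤ Real.sqrt (ω * Real.log t / ((pulls I istar (t - 1)).card : ℝ)) :=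
    Real.sqrt_nonneg _
  -- The optimal arm's bonus enters only through its sign; a gap of `D` minus two median errors of
  -- `D/4` leaves `D/2`.
  have h5 : D / 2 ≤ Real.sqrt (ω * Real.log t / ((pulls I (I t) (t - 1)).card : ℝ)) := by linarith
  have hlog : 0 ≤ Real.log t := Real.log_natCast_nonneg t
  rw [Real.le_sqrt' (by positivity)] at h5
  rcases (Nat.cast_nonneg (α := ℝ) (pulls I (I t) (t - 1)).card).eq_or_lt with h | h
  · rw [← h]
    positivity
  · rw [le_div_iff₀ h] at h5
    rw [le_div_iff₀ (by positivity)]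
    nlinarith

open Classical in
/-- Number of suboptimal pulls in terms of the number of rounds with inaccurate medians. -/
lemma IsRun.card_suboptimal_le {K G : ℕ} {b ω D : ℝ} {I : ℕ → Fin K} {Y : ℕ → ℝ}
    (hrun : IsRun G b ω I Y) (hb : 0 ≤ b) (hG : 1 ≤ G) (hω : 0 ≤ ω) (hD : 0 < D)
    {μ : Fin K → ℝ} {istar : Fin K} (hgap : ∀ i, i ≠ istar → D ≤ μ istar - μ i) (bad : Set ℕ)
    (hgood : ∀ t, initRounds K G b < t → ¬ IsExplorationRound K G b t → t ∉ bad →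
      ∀ j, |empMedian (pulls I j (t - 1)) Y - μ j| ≤ D / 4) (T : ℕ) :
    (((Finset.Icc 1 T).filter (fun t => I t ≠ istar)).card : ℝ) ≤
      K * dueExploration b G 1 + K * dueExploration b G (T / G + 1)
        + K * (4 * ω * Real.log T / D ^ 2 + 1) + ((Finset.Icc 1 T).filter (· ∈ bad)).card := by
  set U : Fin K → Finset ℕ := fun i => (Finset.Icc 1 T).filter (fun t => initRounds K G b < t ∧
    ¬ IsExplorationRound K G b t ∧ t ∉ bad ∧ I t ≠ istar ∧ I t = i) with hU
  have hcover : (Finset.Icc 1 T).filter (fun t => I t ≠ istar) ⊆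
      ((Finset.Icc 1 (initRounds K G b) ∪ (Finset.Icc 1 T).filter (IsExplorationRound K G b))
        ∪ Finset.univ.biUnion U) ∪ (Finset.Icc 1 T).filter (· ∈ bad) := by
    intro t ht
    simp only [Finset.mem_filter, Finset.mem_Icc] at ht
    simp only [hU, Finset.mem_union, Finset.mem_filter, Finset.mem_Icc, Finset.mem_biUnion,
      Finset.mem_univ, true_and]
    by_cases h1 : t ≤ initRounds K G b
    · exact Or.inl (Or.inl (Or.inl ⟨ht.1.1, h1⟩))
    by_cases h2 : IsExplorationRound K G b t
    · exact Or.inl (Or.inl (Or.inr ⟨ht.1, h2⟩))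
    by_cases h3 : t ∈ bad
    · exact Or.inr ⟨ht.1, h3⟩
    · exact Or.inl (Or.inr ⟨I t, ht.1, not_le.1 h1, h2, h3, ht.2, rfl⟩)
  have hUcard : ∀ i, ((U i).card : ℝ) ≤ 4 * ω * Real.log T / D ^ 2 + 1 := by
    intro i
    have hlogT : 0 ≤ Real.log T := Real.log_natCast_nonneg T
    refine card_le_of_card_pulls_le (I := I) (i := i) (by positivity) fun t ht => ?_
    simp only [hU, Finset.mem_filter, Finset.mem_Icc] at ht
    obtain ⟨⟨h1, hT⟩, h2, h3, h4, h5, rfl⟩ := ht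
    refine ⟨h1, rfl, (hrun.card_pulls_le_of_suboptimal hω hD hgap h2 h3 (hgood t h2 h3 h4) h5).trans
      ?_⟩
    have : (0 : ℝ) < t := by exact_mod_cast h1
    gcongr
  have hE := card_explorationRounds_le (K := K) hb hG T
    (S := (Finset.Icc 1 T).filter (IsExplorationRound K G b)) (by
      intro t ht
      simp only [Finset.mem_filter, Finset.mem_Icc] at ht
      exact ⟨ht.1.2, ht.2⟩)
  have hE' : (((Finset.Icc 1 T).filter (IsExplorationRound K G b)).card : ℝ) ≤
      K * dueExploration b G (T / G + 1) := by exact_mod_cast hE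
  have hbi : ((Finset.univ.biUnion U).card : ℝ) ≤ K * (4 * ω * Real.log T / D ^ 2 + 1) := by
    calc ((Finset.univ.biUnion U).card : ℝ) ≤ ∑ i, ((U i).card : ℝ) := by
          exact_mod_cast Finset.card_biUnion_le
      _ ≤ ∑ _i : Fin K, (4 * ω * Real.log T / D ^ 2 + 1) := Finset.sum_le_sum fun i _ => hUcard i
      _ = _ := by
        simp
        ring
  have hcard := ((Finset.card_le_card hcover).trans (Finset.card_union_le _ _)).trans
    (Nat.add_le_add_right ((Finset.card_union_le _ _).trans
      (Nat.add_le_add_right (Finset.card_union_le _ _) _)) _)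
  rw [Nat.card_Icc, Nat.add_sub_cancel, initRounds] at hcard
  have hcard' := (Nat.cast_le (α := ℝ)).2 hcard
  push_cast at hcard'
  linarith

/-- Uses `(⌊T/G⌋ + 1) G ≤ 2T`; the rounding terms and `log 2` are absorbed through `log T ≥ 1`,
valid as `T > 3 > e`. -/
lemma dueExploration_one_add_le {b : ℝ} (hb : 0 ≤ b) {G T : ℕ} (hG : 3 ≤ G) (hT : G < T) :
    (dueExploration b G 1 : ℝ) + dueExploration b G (T / G + 1) ≤ (3 * b + 2) * Real.log T
      ∧ 1 ≤ Real.log T := by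
  have hG' : (3 : ℝ) ≤ G := by exact_mod_cast hG
  have hT' : (G : ℝ) < T := by exact_mod_cast hT
  have hlog : 1 ≤ Real.log T := by
    rw [Real.le_log_iff_exp_le (by linarith)]
    exact Real.exp_one_lt_three.le.trans (by linarith)
  have key : ∀ k : ℕ, 1 ≤ k →
      (dueExploration b G k : ℝ) ≤ b * Real.log ((k : ℝ) * G) + 1 := by
    intro k hk
    have hk' : (1 : ℝ) ≤ k := by exact_mod_cast hk
    exact (Nat.ceil_lt_add_one (mul_nonneg hb (Real.log_nonneg (by nlinarith)))).le
  have h1 := key 1 le_rfl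
  have h2 := key (T / G + 1) (Nat.le_add_left 1 _)
  have h3 : Real.log (((1 : ℕ) : ℝ) * G) ≤ Real.log T := by
    apply Real.log_le_log <;> push_cast <;> linarith
  have h4 : Real.log (((T / G + 1 : ℕ) : ℝ) * G) ≤ Real.log 2 + Real.log T := by
    rw [← Real.log_mul (by norm_num) (by linarith)]
    have : (T / G + 1) * G ≤ 2 * T := by
      have := Nat.div_mul_le_self T G
      rw [Nat.add_mul]
      omega
    have h5 : ((T / G + 1 : ℕ) : ℝ) * G ≤ 2 * T := by exact_mod_cast this
    apply Real.log_le_log _ h5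
    have : (1 : ℝ) ≤ ((T / G + 1 : ℕ) : ℝ) := by exact_mod_cast Nat.le_add_left 1 (T / G)
    nlinarith
  have h6 : Real.log 2 ≤ 1 := by linarith [Real.log_two_lt_d9]
  have h7 := mul_le_mul_of_nonneg_left h3 hb
  have h8 := mul_le_mul_of_nonneg_left h4 hb
  have h9 : b * Real.log 2 ≤ b * Real.log T := mul_le_mul_of_nonneg_left (h6.trans hlog) hb
  refine ⟨?_, hlog⟩
  nlinarith

end MedEUCB

/-! ### Probability of inaccurate medians, and the pathwise regret bound -/

namespace MedEUCB

open scoped ENNReal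

/-- The event that the weight of arm `j` for the rounds with a clean reward in `s` or an attack is
atypically large before round `t`. -/
def tailEvent {K : ℕ} {Ω : Type*} (b ε : ℝ) (X : Fin K → ℕ → Ω → ℝ) (A : ℕ → Set Ω)
    (I : ℕ → Ω → Fin K) (s : Set ℝ) (j : Fin K) (t : ℕ) : Set Ω :=
  {x | ENNReal.ofReal ((1 - 2 * ε ^ 2)⁻¹ ^ (⌈b * Real.log t⌉₊ - K)) ≤
    tailWeight ε (fun τ => X j τ ⁻¹' s ∪ A τ) I j (t - 1) x}

/-- An event outside of which all medians before round `t` are accurate up to `D / 4`. -/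
def badEvent {K : ℕ} {Ω : Type*} (b ε D : ℝ) (μ : Fin K → ℝ) (X : Fin K → ℕ → Ω → ℝ)
    (A : ℕ → Set Ω) (I : ℕ → Ω → Fin K) (t : ℕ) : Set Ω :=
  ⋃ j, (tailEvent b ε X A I (Set.Ioi (μ j + D / 4)) j t ∪
    tailEvent b ε X A I (Set.Iio (μ j - D / 4)) j t)

section

variable {K : ℕ} {Ω : Type*} {m : MeasurableSpace Ω} {P : Measure Ω} {ℱ : Filtration ℕ m}
  {μ : Fin K → ℝ} {σ ρ : ℝ} {X : Fin K → ℕ → Ω → ℝ} {A : ℕ → Set Ω} {η : ℕ → Ω → ℝ}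
  {G : ℕ} {b ω ε D : ℝ} {I : ℕ → Ω → Fin K}

lemma IsAttackedGaussianBandit.measurableSet_union (hB : IsAttackedGaussianBandit P ℱ μ σ ρ X A η)
    {s : Set ℝ} (hs : MeasurableSet s) (j : Fin K) (t : ℕ) :
    MeasurableSet[ℱ (t + 1)] (X j (t + 1) ⁻¹' s ∪ A (t + 1)) :=
  MeasurableSet.union (hB.reward_meas j t hs) (hB.attack_meas t)

lemma measurableSet_tailEvent (hB : IsAttackedGaussianBandit P ℱ μ σ ρ X A η)
    (hI : ∀ t, Measurable[ℱ t] (I (t + 1))) {s : Set ℝ} (hs : MeasurableSet s) (j : Fin K)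
    (t : ℕ) : MeasurableSet (tailEvent b ε X A I s j t) :=
  measurableSet_le measurable_const
    ((measurable_pullWeight _ _ j hI (hB.measurableSet_union hs j) (t - 1)).mono (ℱ.le _) le_rfl)

lemma measurableSet_badEvent (hB : IsAttackedGaussianBandit P ℱ μ σ ρ X A η)
    (hI : ∀ t, Measurable[ℱ t] (I (t + 1))) (t : ℕ) :
    MeasurableSet (badEvent b ε D μ X A I t) :=
  MeasurableSet.iUnion fun j => (measurableSet_tailEvent hB hI measurableSet_Ioi j t).union
    (measurableSet_tailEvent hB hI measurableSet_Iio j t)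

lemma measureReal_tailEvent_le [IsProbabilityMeasure P]
    (hB : IsAttackedGaussianBandit P ℱ μ σ ρ X A η)
    (hI : ∀ t, Measurable[ℱ t] (I (t + 1))) (h0 : 0 ≤ ε) (h1 : ε ≤ 1 / 2) (hbε : 2 ≤ b * ε ^ 2)
    {s : Set ℝ} (hs : MeasurableSet s) (j : Fin K)
    (hlaw : gaussianReal (μ j) (Real.toNNReal (σ ^ 2)) s + ENNReal.ofReal ρ ≤
      ENNReal.ofReal (1 / 2 - ε)) {t : ℕ} (ht : 1 ≤ t) :
    P.real (tailEvent b ε X A I s j t) ≤ Real.exp (K / 2) * ((t : ℝ) ^ 2)⁻¹ := by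
  have ht' : (1 : ℝ) ≤ t := by exact_mod_cast ht
  have hlog : 0 ≤ Real.log t := Real.log_nonneg ht'
  have htail := measure_inv_pow_le_tailWeight_le (P := P) h0 h1
    (E := fun τ => X j τ ⁻¹' s ∪ A τ) j hI
    (hB.measurableSet_union hs j) (by
      intro n f hf
      have hXm := (hB.reward_meas j n).mono (ℱ.le _) le_rfl
      refine (lintegral_mul_indicator_union_le (ℱ.le n) hXm (ℱ.le _ _ (hB.attack_meas n))
        (hB.reward_indep j n) (hB.attack_indep n) hs hf).trans ?_
      gcongr
      rw [← Measure.map_apply hXm hs, hB.reward_law, ← ofReal_measureReal (s := A (n + 1)),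
        hB.attack_prob]
      exact hlaw) (t - 1) (⌈b * Real.log t⌉₊ - K)
  refine (ENNReal.toReal_le_of_le_ofReal (Real.exp_pos _).le htail).trans ?_
  have hexp : Real.exp (K / 2) * ((t : ℝ) ^ 2)⁻¹ = Real.exp (K / 2 - 2 * Real.log t) := by
    rw [Real.exp_sub, ← Real.log_rpow (by linarith), Real.exp_log (by positivity), div_eq_mul_inv]
    norm_cast
  rw [hexp]
  apply Real.exp_le_exp.2
  -- Truncated subtraction only helps here. The lost `K` pulls cost `exp(2ε²K) ≤ exp(K/2)`, and `b
  -- ε² ≥ 2` more than pays for `t⁻²`.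
  have hk : b * Real.log t - K ≤ ((⌈b * Real.log t⌉₊ - K : ℕ) : ℝ) := by
    have h2 : b * Real.log t ≤ ⌈b * Real.log t⌉₊ := Nat.le_ceil _
    have h3 : (⌈b * Real.log t⌉₊ : ℝ) ≤ ((⌈b * Real.log t⌉₊ - K : ℕ) : ℝ) + K := by
      exact_mod_cast (by omega : ⌈b * Real.log t⌉₊ ≤ ⌈b * Real.log t⌉₊ - K + K)
    linarith
  have hK : (0 : ℝ) ≤ K := Nat.cast_nonneg K
  have h4 := mul_le_mul_of_nonneg_left hk (by positivity : 0 ≤ 2 * ε ^ 2)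
  have h5 := mul_le_mul_of_nonneg_right hbε hlog
  have h6 : ε ^ 2 ≤ 1 / 4 := by nlinarith
  have h7 := mul_le_mul_of_nonneg_right h6 hK
  nlinarith

lemma measureReal_badEvent_le [IsProbabilityMeasure P]
    (hB : IsAttackedGaussianBandit P ℱ μ σ ρ X A η) (hI : ∀ t, Measurable[ℱ t] (I (t + 1)))
    (hσ : 0 < σ) (hρ : 0 ≤ ρ) (hε : ε = Phi (D / (4 * σ)) - 1 / 2 - ρ) (h0 : 0 ≤ ε)
    (h1 : ε ≤ 1 / 2) (hbε : 2 ≤ b * ε ^ 2) {t : ℕ} (ht : 1 ≤ t) :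
    P.real (badEvent b ε D μ X A I t) ≤ 2 * K * Real.exp (K / 2) * ((t : ℝ) ^ 2)⁻¹ := by
  have hq : ENNReal.ofReal (1 - Phi (D / 4 / σ)) + ENNReal.ofReal ρ = ENNReal.ofReal (1 / 2 - ε) := by
    rw [div_div, ← ENNReal.ofReal_add (by linarith [Phi_le_one (D / (4 * σ))]) hρ, hε]
    congr 1
    ring
  calc P.real (badEvent b ε D μ X A I t)
      ≤ ∑ j, P.real (tailEvent b ε X A I (Set.Ioi (μ j + D / 4)) j t ∪
          tailEvent b ε X A I (Set.Iio (μ j - D / 4)) j t) := measureReal_iUnion_fintype_le _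
    _ ≤ ∑ _j : Fin K, 2 * (Real.exp (K / 2) * ((t : ℝ) ^ 2)⁻¹) := by
        refine Finset.sum_le_sum fun j _ => (measureReal_union_le _ _).trans ?_
        rw [two_mul]
        refine add_le_add ?_ ?_
        · exact measureReal_tailEvent_le hB hI h0 h1 hbε measurableSet_Ioi j
            (by rw [gaussianReal_Ioi hσ, hq]) ht
        · exact measureReal_tailEvent_le hB hI h0 h1 hbε measurableSet_Iio j
            (by rw [gaussianReal_Iio hσ, hq]) ht
    _ = _ := by
        rw [Finset.sum_const, Finset.card_univ, Fintype.card_fin, nsmul_eq_mul]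
        ring

/-- A wrong median puts half of the observed rewards beyond the level. Each such round is either
attacked or shows the clean reward of `j`, so the weight is large and the bad event occurs. -/
lemma abs_empMedian_sub_le_of_notMem_badEvent (h0 : 0 ≤ ε) (h1 : ε ≤ 1 / 2) {x : Ω} {t : ℕ}
    (hx : x ∉ badEvent b ε D μ X A I t) (j : Fin K)
    (hpos : 0 < (pulls (fun t => I t x) j (t - 1)).card)
    (hcard : b * Real.log t ≤ (pulls (fun t => I t x) j (t - 1)).card + K) :
    |empMedian (pulls (fun t => I t x) j (t - 1)) (fun t => observed X A η I t x) - μ j|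
      ≤ D / 4 := by
  simp only [badEvent, Set.mem_iUnion, Set.mem_union, not_exists, not_or] at hx
  obtain ⟨hup, hlo⟩ := hx j
  have hk : ⌈b * Real.log t⌉₊ - K ≤ (pulls (fun t => I t x) j (t - 1)).card := by
    have : ⌈b * Real.log t⌉₊ ≤ (pulls (fun t => I t x) j (t - 1)).card + K := by
      rw [Nat.ceil_le]
      exact_mod_cast hcard
    omega
  have hobs : ∀ τ ∈ pulls (fun t => I t x) j (t - 1), x ∉ A τ → observed X A η I τ x = X j τ x := by
    intro τ hτ hA
    simp only [pulls, Finset.mem_filter] at hτ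
    simp [observed, hA, hτ.2]
  rw [abs_sub_le_iff]
  constructor
  · by_contra hlt
    refine hup (inv_pow_le_pullWeight h0 h1 hk ?_ (Finset.filter_subset _ _)
      (card_le_of_lt_empMedian hpos
        (x := fun t => observed X A η I t x) (y := μ j + D / 4) (by linarith)))
    intro τ hτ
    rw [Finset.mem_filter] at hτ
    by_cases hA : x ∈ A τ
    · exact Or.inr hA
    · left
      have := hτ.2
      rw [hobs τ hτ.1 hA] at this
      exact this
  · by_contra hlt
    refine hlo (inv_pow_le_pullWeight h0 h1 hk ?_ (Finset.filter_subset _ _)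
      (card_le_of_empMedian_lt hpos
        (x := fun t => observed X A η I t x) (y := μ j - D / 4) (by linarith)))
    intro τ hτ
    rw [Finset.mem_filter] at hτ
    by_cases hA : x ∈ A τ
    · exact Or.inr hA
    · left
      have := hτ.2
      rw [hobs τ hτ.1 hA] at this
      exact this

lemma regret_eq_sum (istar : Fin K) (T : ℕ) (x : Ω) :
    regret μ istar I T x = ∑ t ∈ Finset.Icc 1 T, (μ istar - μ (I t x)) := by
  rw [regret, Finset.sum_sub_distrib, Finset.sum_const, Nat.card_Icc, nsmul_eq_mul,
    Nat.add_sub_cancel, mul_comm]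

open Classical in
lemma regret_le_mul_card {istar : Fin K} (hstar : ∀ i, i ≠ istar → μ i < μ istar) (T : ℕ) (x : Ω) :
    regret μ istar I T x ≤ (∑ i, (μ istar - μ i)) *
      ((Finset.Icc 1 T).filter (fun t => I t x ≠ istar)).card := by
  have hnn : ∀ i, 0 ≤ μ istar - μ i := fun i => by
    by_cases h : i = istar
    · rw [h, sub_self]
    · exact (sub_pos.2 (hstar i h)).le
  rw [regret_eq_sum, mul_comm, ← nsmul_eq_mul, ← Finset.sum_const, Finset.sum_filter]
  refine Finset.sum_le_sum fun t _ => ?_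
  split_ifs with h
  · exact Finset.single_le_sum (f := fun i => μ istar - μ i) (fun i _ => hnn i) (Finset.mem_univ _)
  · rw [not_not.1 h, sub_self]

/-- On every trajectory the regret is logarithmic up to the number of bad rounds. -/
lemma regret_le_log_add (hP : PlaysMedEUCB ℱ G b ω X A η I) (hK : 1 ≤ K) (hb : 8 ≤ b)
    (hG : 3 ≤ G) (hKb : (K : ℝ) * b * Real.log G ≤ G) (hω : 0 ≤ ω) (hD : 0 < D) {istar : Fin K}
    (hstar : ∀ i, i ≠ istar → μ i < μ istar) (hgap : ∀ i, i ≠ istar → D ≤ μ istar - μ i)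
    (h0 : 0 ≤ ε) (h1 : ε ≤ 1 / 2) {T : ℕ} (hT : G < T) (x : Ω) :
    regret μ istar I T x ≤ (∑ i, (μ istar - μ i)) * (K * (3 * b + 3 + 4 * ω / D ^ 2)) * Real.log T
      + (∑ i, (μ istar - μ i)) *
        ∑ t ∈ Finset.Icc 1 T, (badEvent b ε D μ X A I t).indicator (fun _ => (1 : ℝ)) x := by
  classical
  have hM : 0 ≤ ∑ i, (μ istar - μ i) := Finset.sum_nonneg fun i _ => by
    by_cases h : i = istar
    · rw [h, sub_self]
    · exact (sub_pos.2 (hstar i h)).le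
  have hrun := hP.run x
  have hcard := hrun.card_suboptimal_le (by linarith) (by omega) hω hD hgap
    {t | x ∈ badEvent b ε D μ X A I t} (fun t h2 h3 h4 j =>
      abs_empMedian_sub_le_of_notMem_badEvent h0 h1 h4 j (hrun.card_pulls_pos hb hG j h2)
        (hrun.mul_log_le_card_pulls hK hb hG hKb j h2 h3)) T
  obtain ⟨hdue, hlog⟩ := dueExploration_one_add_le (b := b) (by linarith) hG hT
  have hN : ∑ t ∈ Finset.Icc 1 T, (badEvent b ε D μ X A I t).indicator (fun _ => (1 : ℝ)) x =
      ((Finset.Icc 1 T).filter (· ∈ {t | x ∈ badEvent b ε D μ X A I t})).card := by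
    simp [Set.indicator_apply]
  rw [hN]
  have hKK : (0 : ℝ) ≤ K := Nat.cast_nonneg K
  have h2 := mul_le_mul_of_nonneg_left hdue hKK
  -- Absorbs the one extra pull per arm into `log T`, turning `3b + 2` into `3b + 3`.
  have h3 := mul_le_mul_of_nonneg_left hlog hKK
  have h4 : 4 * ω * Real.log T / D ^ 2 = 4 * ω / D ^ 2 * Real.log T := by ring
  rw [h4] at hcard
  rw [mul_assoc, ← mul_add]
  refine (regret_le_mul_card hstar T x).trans (mul_le_mul_of_nonneg_left (hcard.trans ?_) hM)
  nlinarith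

end

/-! ### From few bad rounds to the expectation and high-probability bounds -/

section

variable {Ω : Type*} {m : MeasurableSpace Ω} {P : Measure Ω} [IsProbabilityMeasure P]

lemma sum_indicator_properties {B : ℕ → Set Ω} (hB : ∀ t, MeasurableSet (B t)) {c : ℝ}
    (hc : 0 ≤ c) (hP : ∀ t, 1 ≤ t → P.real (B t) ≤ c * ((t : ℝ) ^ 2)⁻¹) (T : ℕ) :
    Integrable (fun x => ∑ t ∈ Finset.Icc 1 T, (B t).indicator (fun _ => (1 : ℝ)) x) P ∧
    ∫ x, ∑ t ∈ Finset.Icc 1 T, (B t).indicator (fun _ => (1 : ℝ)) x ∂P ≤ 2 * c := by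
  have hint : ∀ t ∈ Finset.Icc 1 T, Integrable ((B t).indicator (fun _ => (1 : ℝ))) P :=
    fun t _ => (integrable_const 1).indicator (hB t)
  refine ⟨integrable_finsetSum _ hint, ?_⟩
  rw [integral_finsetSum _ hint]
  calc ∑ t ∈ Finset.Icc 1 T, ∫ x, (B t).indicator (fun _ => (1 : ℝ)) x ∂P
      ≤ ∑ t ∈ Finset.Icc 1 T, c * ((t : ℝ) ^ 2)⁻¹ := by
        refine Finset.sum_le_sum fun t ht => ?_
        rw [integral_indicator_const _ (hB t), smul_eq_mul, mul_one]
        exact hP t (Finset.mem_Icc.1 ht).1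
    _ = c * ∑ t ∈ Finset.Ioo 0 (T + 1), ((t : ℝ) ^ 2)⁻¹ := by
        rw [← Finset.mul_sum]
        congr 2
    _ ≤ c * (2 / (((0 : ℕ) : ℝ) + 1)) := by
        gcongr
        exact sum_Ioo_inv_sq_le 0 (T + 1)
    _ = 2 * c := by
        norm_num [mul_comm]

lemma one_sub_le_of_le_add_mul {R N : Ω → ℝ} {a M c δ : ℝ} (hR : ∀ x, R x ≤ a + M * N x)
    (hN0 : ∀ x, 0 ≤ N x) (hN : Integrable N P) (hNc : ∫ x, N x ∂P ≤ c) (hc : 0 < c) (hM : 0 ≤ M)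
    (hδ : 0 < δ) : 1 - δ ≤ P.real {x | R x ≤ a + M * (c / δ)} := by
  have hmk := mul_meas_ge_le_integral_of_nonneg (μ := P) (Filter.Eventually.of_forall hN0) hN (c / δ)
  have hle : P.real {x | c / δ ≤ N x} ≤ δ := by
    have h1 := hmk.trans hNc
    rw [div_mul_eq_mul_div, div_le_iff₀ hδ] at h1
    exact le_of_mul_le_mul_left h1 hc
  have hsub : {x | R x ≤ a + M * (c / δ)}ᶜ ⊆ {x | c / δ ≤ N x} := by
    intro x hx
    by_contra hlt
    refine hx ((hR x).trans ?_)
    have := mul_le_mul_of_nonneg_left (not_le.1 hlt).le hM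
    linarith
  have h2 := measureReal_mono (μ := P) hsub
  -- Subadditivity instead of the complement formula: the event is not known to be measurable here.
  have h3 := measureReal_union_le (μ := P) {x | R x ≤ a + M * (c / δ)}
    {x | R x ≤ a + M * (c / δ)}ᶜ
  rw [Set.union_compl_self, probReal_univ] at h3
  linarith

lemma pseudoRegret_le {K : ℕ} {ℱ : Filtration ℕ m} {μ : Fin K → ℝ} {istar : Fin K}
    {I : ℕ → Ω → Fin K} (hI : ∀ t, Measurable[ℱ t] (I (t + 1))) {T : ℕ} {N : Ω → ℝ} {a M c : ℝ}
    (hR : ∀ x, regret μ istar I T x ≤ a + M * N x) (hN : Integrable N P)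
    (hNc : ∫ x, N x ∂P ≤ c) (hM : 0 ≤ M) : pseudoRegret P μ istar I T ≤ a + M * c := by
  have hint : Integrable (fun x => ∑ t ∈ Finset.Icc 1 T, μ (I t x)) P := by
    refine integrable_finsetSum _ fun t ht => ?_
    obtain ⟨s, rfl⟩ : ∃ s, t = s + 1 := ⟨t - 1, by have := (Finset.mem_Icc.1 ht).1; omega⟩
    have hIm : Measurable (I (s + 1)) := (hI s).mono (ℱ.le s) le_rfl
    refine Integrable.of_bound ((measurable_of_finite μ).comp hIm).aestronglyMeasurable
      (∑ i, ‖μ i‖) (Filter.Eventually.of_forall fun x => ?_)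
    exact Finset.single_le_sum (f := fun i => ‖μ i‖) (fun i _ => norm_nonneg _)
      (Finset.mem_univ _)
  calc pseudoRegret P μ istar I T = ∫ x, regret μ istar I T x ∂P := by
        unfold pseudoRegret regret
        rw [integral_sub (integrable_const _) hint, integral_const, probReal_univ, one_smul]
    _ ≤ ∫ x, (a + M * N x) ∂P :=
        integral_mono ((integrable_const _).sub hint)
          ((integrable_const a).add (hN.const_mul M)) hR
    _ = a + M * ∫ x, N x ∂P := by
        rw [integral_add (integrable_const a) (hN.const_mul M), integral_const, probReal_univ,
          one_smul, integral_const_mul]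
    _ ≤ a + M * c := by gcongr

end

end MedEUCB

theorem corollary1 (K : ℕ) (hK : 2 ≤ K) (μ : Fin K → ℝ) (istar : Fin K)
    (hstar : ∀ i, i ≠ istar → μ i < μ istar) (b ω : ℝ) :
    ∃ C : ℝ, 0 < C ∧
      ∀ (σ ρ : ℝ) (G : ℕ), 0 < σ → 0 < ρ →
        ρ < MedEUCB.Phi (MedEUCB.gapMin μ istar / (4 * σ)) - 1 / 2 →
        2 / (MedEUCB.densityBound (MedEUCB.gapMin μ istar) σ) ^ 2 ≤ ω →
        max ω (2 / (MedEUCB.Phi (MedEUCB.gapMin μ istar / (4 * σ)) - 1 / 2 - ρ) ^ 2) ≤ b →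
        2 ≤ G → (K : ℝ) * b * Real.log (G : ℝ) ≤ (G : ℝ) →
        ∀ (Ω : Type*) (m : MeasurableSpace Ω) (P : Measure Ω) (_ : IsProbabilityMeasure P)
          (ℱ : Filtration ℕ m) (X : Fin K → ℕ → Ω → ℝ) (A : ℕ → Set Ω) (η : ℕ → Ω → ℝ)
          (I : ℕ → Ω → Fin K),
          MedEUCB.IsAttackedGaussianBandit P ℱ μ σ ρ X A η →
          MedEUCB.PlaysMedEUCB ℱ G b ω X A η I →
          ∀ T : ℕ, G < T →
            MedEUCB.pseudoRegret P μ istar I T ≤ C * Real.log (T : ℝ) ∧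
            ∀ δ : ℝ, 0 < δ → δ < 1 →
              1 - δ ≤ P.real {x | MedEUCB.regret μ istar I T x
                ≤ C * (Real.log (T : ℝ) + 1 / δ)} := by
  have hKpos : (0 : ℝ) < K := by exact_mod_cast (by omega : 0 < K)
  have hD := MedEUCB.gapMin_pos hK hstar
  set D := MedEUCB.gapMin μ istar
  set M := ∑ i, (μ istar - μ i) with hMdef
  have hM : 0 ≤ M := Finset.sum_nonneg fun i _ => by
    by_cases h : i = istar
    · rw [h, sub_self]
    · exact (sub_pos.2 (hstar i h)).le
  set a := M * (K * (3 * b + 3 + 4 * ω / D ^ 2)) with ha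
  set c := 2 * (2 * K * Real.exp ((K : ℝ) / 2)) with hc
  have hcpos : 0 < c := by positivity
  have hMc : 0 ≤ M * c := by positivity
  -- `C` is fixed before the signs of `b` and `ω` are known, hence `|a|`. The leading 2 in `c`
  -- bounds `∑ t⁻²`; the rest is the constant in the bad-event estimate.
  refine ⟨1 + |a| + M * c, by positivity, ?_⟩
  intro σ ρ G hσ hρ hρΦ hω hbmax hG hKb Ω m P _ ℱ X A η I hB hP T hT
  set ε := MedEUCB.Phi (D / (4 * σ)) - 1 / 2 - ρ with hε
  have hε0 : 0 < ε := by linarith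
  have hε1 : ε ≤ 1 / 2 := by linarith [MedEUCB.Phi_le_one (D / (4 * σ))]
  have hbε : 2 ≤ b * ε ^ 2 := (div_le_iff₀ (by positivity)).1 ((le_max_right _ _).trans hbmax)
  -- From `b ε² ≥ 2` and `ε ≤ 1/2`.
  have hb : 8 ≤ b := by
    have h1 : ε ^ 2 ≤ 1 / 4 := by nlinarith
    by_contra hlt
    nlinarith [sq_nonneg ε, pow_pos hε0 2]
  have hω0 : 0 ≤ ω := le_trans (by positivity) hω
  have hG3 := MedEUCB.three_le_groupSize (by omega) hb hG hKb
  have hlog := (MedEUCB.dueExploration_one_add_le (b := b) (by linarith) hG3 hT).2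
  have hR := MedEUCB.regret_le_log_add hP (by omega) hb hG3 hKb hω0 hD hstar
    (fun i hi => MedEUCB.gapMin_le μ istar hi) hε0.le hε1 hT
  obtain ⟨hN, hNc⟩ := MedEUCB.sum_indicator_properties (P := P)
    (fun t => MedEUCB.measurableSet_badEvent (b := b) (ε := ε) (D := D) hB hP.nonanticipating t)
    (by positivity) (fun t ht => MedEUCB.measureReal_badEvent_le hB hP.nonanticipating hσ hρ.le hε
      hε0.le hε1 hbε ht) T
  have hale := le_abs_self a
  have habs := abs_nonneg a
  constructor
  · refine (MedEUCB.pseudoRegret_le hP.nonanticipating hR hN hNc hM).trans ?_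
    nlinarith
  · intro δ hδ hδ1
    refine (MedEUCB.one_sub_le_of_le_add_mul hR
      (fun x => Finset.sum_nonneg fun t _ => Set.indicator_nonneg (fun _ _ => zero_le_one) x)
      hN hNc hcpos hM hδ).trans (measureReal_mono fun x hx => ?_)
    refine le_trans (Set.mem_ofPred_eq ▸ hx) ?_
    have hδinv : 0 < 1 / δ := by positivity
    have h1 : M * (c / δ) = M * c * (1 / δ) := by ring
    rw [h1]
    nlinarith [mul_nonneg habs hδinv.le, mul_nonneg hMc (by linarith : 0 ≤ Real.log T)]
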